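/- Let $d\ge 2$ and $r\ge 1$ be integers and let $P_k^+,P_k^-\in\mathbb R^{r\times r}$ ($k\in\mathbb Z$). Let $\phi=[\phi_1,\dots,\phi_r]^T:\mathbb R\to\mathbb C^r$ be a two-direction multiscaling function with dilation factor $d$: that is, $$\phi(x)=\sqrt d\sum_{k\in\mathbb Z}\bigl[P_k^+\phi(dx-k)+P_k^-\phi(k-dx)\bigr]\quad\text{for a.e. }x,$$ and $\phi$ generates a multiresolution approximation of $L^2(\mathbb R)$, i.e. $\phi_i\in L^2(\mathbb R)$, the closed spans $V_n$ of $\{\phi_i(d^nx-k),\ \phi_i(k-d^nx): 1\le i\le r,\ k\in\mathbb Z\}$ ($n\in\mathbb Z$) are nested ($V_n\subset V_{n+1}$), $\bigcup_nV_n$ is dense in $L^2(\mathbb R)$, $\bigcap_nV_n=\{0\}$, and the functions $\phi_i(x-k),\phi_i(k-x)$ form a Riesz basis of $V_0$. Assume that * $\phi$ is orthogonal: $\int\phi(x-j)\phi(x-k)^*\,dx=\delta_{jk}I_r$ and $\int\phi(x-j)\phi(k-x)^*\,dx=0$ for all $j,k\in\mathbb Z$; * $\phi$ is continuous and has compact support;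 * $\phi$ satisfies Condition E: the matrix $M_0^\pm$ below has $1$ as a simple eigenvalue, and all its other eigenvalues are smaller than $1$ in absolute value. Let $\psi^{(s)}:\mathbb R\to\mathbb C^r$, $s=1,\dots,d-1$, be associated two-direction multiwavelets, $\psi^{(s)}(x)=\sqrt d\sum_{k}\bigl[Q_k^{(s)+}\phi(dx-k)+Q_k^{(s)-}\phi(k-dx)\bigr]$ for a.e. $x$, with $Q_k^{(s)\pm}\in\mathbb R^{r\times r}$. Put $\Phi(x)=[\phi(x),\phi(-x)]^T$, $\Psi^{(s)}(x)=[\psi^{(s)}(x),\psi^{(s)}(-x)]^T$ and, for $j=0,1,2,\dots$, $$M_j^\pm=\frac1{\sqrt d}\sum_{k\in\mathbb Z}k^j\begin{bmatrix}P_k^+&P_k^-\\P_{-k}^-&P_{-k}^+\end{bmatrix},\qquad N_j^{(s)\pm}=\frac1{\sqrt d}\sum_{k\in\mathbb Z}k^j\begin{bmatrix}Q_k^{(s)+}&Q_k^{(s)-}\\Q_{-k}^{(s)-}&Q_{-k}^{(s)+}\end{bmatrix},$$ $$\mathbf m_j=\int x^j\phi(x)\,dx,\quad \mathbf m_j^\pm=\int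 x^j\Phi(x)\,dx,\quad \mathbf n_j^{(s)}=\int x^j\psi^{(s)}(x)\,dx,\quad \mathbf n_j^{(s)\pm}=\int x^j\Psi^{(s)}(x)\,dx .$$ Then the series for $M_j^\pm$ and the integrals for $\mathbf m_j^\pm$ converge absolutely for all $j\ge0$, and: 1. $M_0^\pm\mathbf m_0^\pm=\mathbf m_0^\pm$ and $(\mathbf m_0^\pm)^*\mathbf m_0^\pm=1$; these two conditions determine $\mathbf m_0^\pm$ up to a factor $c\in\mathbb C$ with $|c|=1$. 2. For every $j\ge1$ the matrix $d^jI_{2r}-M_0^\pm$ is invertible and $$\mathbf m_j^\pm=(d^jI_{2r}-M_0^\pm)^{-1}\sum_{\ell=0}^{j-1}\binom j\ell M_{j-\ell}^\pm\mathbf m_\ell^\pm .$$ Once $\mathbf m_0^\pm$ is given, this recursion determines all $\mathbf m_j^\pm$ uniquely. 3. For all $s=1,\dots,d-1$ and every $j\ge0$ for which the moment $\mathbf n_j^{(s)}$ exists (that is, $x^j\psi^{(s)}(x)$ is integrable; for all $j$ if $\psi^{(s)}$ has compact support), the integral for $\mathbf n_j^{(s)\pm}$ and the series for $N_0^{(s)\pm},\dots,N_j^{(s)\pm}$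 converge absolutely, and $$\mathbf n_j^{(s)\pm}=d^{-j}\sum_{\ell=0}^{j}\binom j\ell N_{j-\ell}^{(s)\pm}\mathbf m_\ell^\pm .$$ 4. $\mathbf m_j$ is the upper half of $\mathbf m_j^\pm$ for all $j\ge 0$, and $\mathbf n_j^{(s)}$ is the upper half of $\mathbf n_j^{(s)\pm}$ for all $s$, $j$ as in 3. -/

import Mathlib

open MeasureTheory

namespace TwoDirection

noncomputable section

/-- A real matrix, regarded as a complex one. -/
def toComplex {m n : Type*} (A : Matrix m n ℝ) : Matrix m n ℂ := A.map (fun t => (t : ℂ))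

/-- The matrix-valued inner product `⟨f, g⟩ = ∫ f(x) g(x)^* dx`. -/
def innerMat {r : ℕ} (f g : ℝ → Fin r → ℂ) : Matrix (Fin r) (Fin r) ℂ :=
  Matrix.of fun a b => ∫ x, f x a * star (g x b)

/-- `f(x) = √d ∑_k [A_k^+ φ(d x - k) + A_k^- φ(k - d x)]`, for almost every `x`. -/
def IsTwoDirectionSeries {r : ℕ} (d : ℕ) (Ap Am : ℤ → Matrix (Fin r) (Fin r) ℝ)
    (φ f : ℝ → Fin r → ℂ) : Prop :=
  ∀ᵐ x : ℝ, HasSum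
    (fun k : ℤ => Real.sqrt d •
      ((toComplex (Ap k)).mulVec (φ (d * x - k)) + (toComplex (Am k)).mulVec (φ (k - d * x))))
    (f x)

/-- The closed subspace `V_n` of `L²(ℝ)` spanned by the functions `φ_i(d^n x - k)` and
`φ_i(k - d^n x)`, for `i = 1, …, r` and `k ∈ ℤ`. -/
def scaleSpace {r : ℕ} (d : ℕ) (φ : ℝ → Fin r → ℂ) (n : ℤ) :
    Submodule ℂ (Lp ℂ 2 (volume : Measure ℝ)) :=
  (Submodule.span ℂ {f : Lp ℂ 2 (volume : Measure ℝ) | ∃ (i : Fin r) (k : ℤ),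
    (f =ᵐ[volume] fun x : ℝ => φ ((d : ℝ) ^ n * x - k) i) ∨
    (f =ᵐ[volume] fun x : ℝ => φ (k - (d : ℝ) ^ n * x) i)}).topologicalClosure

/-- `φ` generates a (two-direction) multiresolution approximation of `L²(ℝ)` with dilation
factor `d`. That `f ∈ V_n ↔ f(d ·) ∈ V_{n+1}` and that `V_n` is invariant under the shifts by
`d^{-n} ℤ` is built into the definition of `V_n`. -/
structure GeneratesMRA {r : ℕ} (d : ℕ) (φ : ℝ → Fin r → ℂ) : Prop where
  memLp : ∀ i, MemLp (fun x => φ x i) 2 (volume : Measure ℝ)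
  nested : ∀ n : ℤ, scaleSpace d φ n ≤ scaleSpace d φ (n + 1)
  dense : (⨆ n : ℤ, scaleSpace d φ n).topologicalClosure = ⊤
  trivial_inter : (⨅ n : ℤ, scaleSpace d φ n) = ⊥
  /-- the functions `φ_i(x - k)` and `φ_i(k - x)` form a Riesz basis of `V_0` -/
  stable : ∃ A B : ℝ, 0 < A ∧ 0 < B ∧ ∀ cp cm : Fin r × ℤ →₀ ℂ,
    A * ((cp.sum fun _ a => ‖a‖ ^ 2) + cm.sum fun _ a => ‖a‖ ^ 2) ≤
      (∫ x : ℝ, ‖(cp.sum fun p a => a * φ (x - p.2) p.1) +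
        cm.sum fun p a => a * φ (p.2 - x) p.1‖ ^ 2) ∧
    (∫ x : ℝ, ‖(cp.sum fun p a => a * φ (x - p.2) p.1) +
        cm.sum fun p a => a * φ (p.2 - x) p.1‖ ^ 2) ≤
      B * ((cp.sum fun _ a => ‖a‖ ^ 2) + cm.sum fun _ a => ‖a‖ ^ 2)

/-- `φ` is a two-direction multiscaling function of multiplicity `r` and dilation factor `d`
with the recursion coefficients `P_k^+`, `P_k^-`. -/
structure IsMultiscaling {r : ℕ} (d : ℕ) (Pp Pm : ℤ → Matrix (Fin r) (Fin r) ℝ)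
    (φ : ℝ → Fin r → ℂ) : Prop where
  refinement : IsTwoDirectionSeries d Pp Pm φ φ
  generates : GeneratesMRA d φ

/-- Orthogonality of a two-direction multiscaling function. -/
structure IsOrthogonal {r : ℕ} (φ : ℝ → Fin r → ℂ) : Prop where
  same : ∀ j k : ℤ,
    innerMat (fun x => φ (x - j)) (fun x => φ (x - k)) = if j = k then 1 else 0
  opposite : ∀ j k : ℤ, innerMat (fun x => φ (x - j)) (fun x => φ (k - x)) = 0

/-- Condition E: 1 is an (algebraically) simple eigenvalue, and all other eigenvalues are smaller
than 1 in absolute value. -/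
def ConditionE {n : Type*} [Fintype n] [DecidableEq n] (A : Matrix n n ℂ) : Prop :=
  A.charpoly.rootMultiplicity 1 = 1 ∧
    ∀ μ : ℂ, Module.End.HasEigenvalue (Matrix.toLin' A) μ → μ ≠ 1 → ‖μ‖ < 1

/-- The doubled function `[φ(x), φ(-x)]^T`. -/
def doubled {r : ℕ} (φ : ℝ → Fin r → ℂ) (x : ℝ) : Fin r ⊕ Fin r → ℂ :=
  Sum.elim (φ x) (φ (-x))

/-- The `k`-th term `k^j [[A_k^+, A_k^-], [A_{-k}^-, A_{-k}^+]]` of the series for the `j`-th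
discrete moment. -/
def discreteMomentTerm {r : ℕ} (Ap Am : ℤ → Matrix (Fin r) (Fin r) ℝ) (j : ℕ) (k : ℤ) :
    Matrix (Fin r ⊕ Fin r) (Fin r ⊕ Fin r) ℝ :=
  (k : ℝ) ^ j • Matrix.fromBlocks (Ap k) (Am k) (Am (-k)) (Ap (-k))

/-- The `j`-th discrete moment
`d^{-1/2} ∑_k k^j [[A_k^+, A_k^-], [A_{-k}^-, A_{-k}^+]]` of the doubled function, as a complex
matrix. -/
def discreteMoment {r : ℕ} (d : ℕ) (Ap Am : ℤ → Matrix (Fin r) (Fin r) ℝ) (j : ℕ) :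
    Matrix (Fin r ⊕ Fin r) (Fin r ⊕ Fin r) ℂ :=
  toComplex ((1 / Real.sqrt d) • ∑' k : ℤ, discreteMomentTerm Ap Am j k)

/-- The `j`-th continuous moment `∫ x^j f(x) dx`. -/
def continuousMoment {ι : Type*} [Fintype ι] (f : ℝ → ι → ℂ) (j : ℕ) : ι → ℂ :=
  ∫ x : ℝ, (x ^ j) • f x

/-- The upper half of a vector of size `2r`. -/
def upperHalf {r : ℕ} (v : Fin r ⊕ Fin r → ℂ) : Fin r → ℂ := fun i => v (Sum.inl i)

end

end TwoDirection

open TwoDirection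

/-! Dilating by `d` and doubling turns a two-direction series into a series
`G = ∑_k ∑_b α_k(b) Φ_b(· - k)` in compactly supported functions `Φ_b` with orthonormal integer
translates. Orthonormality allows each `α_k(b)` to be read off by testing `G` against a function on
a window around `k`. That function can be chosen bounded, so `α_k(b)` is controlled by the integral
of `|G|` over the window, and integrability of `x^j G` makes the moments of the coefficients up to
order `j` converge absolutely. Expanding `x^j = ((x - k) + k)^j` and integrating termwise gives the
moment formula; applied to `φ` itself it is the recursion, which Condition E makes solvable and
whose starting vector it determines up to normalization. The normalization comes from the indicator
function of `[0, 1]`: the squared norm of its projection onto `V_n` tends to `|m_0|²` by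
orthonormality, boundary effects being negligible, and to `1` by density of the spaces `V_n`.
-/

namespace TwoDirection

open scoped InnerProductSpace ComplexConjugate Pointwise

section BoundedMultiplier

variable {X κ : Type*} [MeasurableSpace X] {μ : Measure X}

/-- The vectors `(∫ w_i θ)_i`, for `θ` bounded. Unlike `L^∞`, this space is finite-dimensional when
`κ` is finite, so a vector outside it is detected by a linear functional. -/
def boundedMomentSpace {w : κ → X → ℂ} (hw : ∀ i, Integrable (w i) μ) :
    Submodule ℂ (κ → ℂ) where
  carrier := {t | ∃ θ : X → ℂ, AEStronglyMeasurable θ μ ∧ (∃ C, ∀ x, ‖θ x‖ ≤ C) ∧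
    ∀ i, ∫ x, w i x * θ x ∂μ = t i}
  zero_mem' := ⟨0, aestronglyMeasurable_zero, ⟨0, by simp⟩, by simp⟩
  add_mem' := by
    rintro s t ⟨θ, hθ, ⟨C, hC⟩, hs⟩ ⟨η, hη, ⟨D, hD⟩, ht⟩
    refine ⟨θ + η, hθ.add hη, ⟨C + D, fun x => norm_add_le_of_le (hC x) (hD x)⟩, fun i => ?_⟩
    simp only [Pi.add_apply, mul_add, ← hs, ← ht]
    exact integral_add ((hw i).mul_bdd hθ (.of_forall hC)) ((hw i).mul_bdd hη (.of_forall hD))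
  smul_mem' := by
    rintro c t ⟨θ, hθ, ⟨C, hC⟩, ht⟩
    refine ⟨c • θ, hθ.const_smul c, ⟨‖c‖ * C, fun x => ?_⟩, fun i => ?_⟩
    · rw [Pi.smul_apply, norm_smul]
      exact mul_le_mul_of_nonneg_left (hC x) (norm_nonneg c)
    · simp only [Pi.smul_apply, smul_eq_mul, mul_left_comm _ c, integral_const_mul, ht]

theorem ae_eq_zero_of_forall_bounded_integral_mul_eq_zero {w : X → ℂ} (hw : Integrable w μ)
    (h : ∀ θ : X → ℂ, AEStronglyMeasurable θ μ → (∃ C, ∀ x, ‖θ x‖ ≤ C) →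
      ∫ x, w x * θ x ∂μ = 0) : w =ᵐ[μ] 0 := by
  have hsign : ∀ x, w x * (conj (w x) / ‖w x‖) = (‖w x‖ : ℂ) := fun x => by
    rw [← mul_div_assoc, RCLike.mul_conj]
    rcases eq_or_ne (w x) 0 with hx | hx
    · simp [hx]
    · have : (‖w x‖ : ℂ) ≠ 0 := by simpa using hx
      field_simp
      rfl
  have hbound : ∀ x, ‖conj (w x) / (‖w x‖ : ℂ)‖ ≤ 1 := fun x => by
    simpa using div_self_le_one ‖w x‖
  have hmeas : AEStronglyMeasurable (fun x => conj (w x) / (‖w x‖ : ℂ)) μ :=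
    ((Complex.continuous_conj.measurable.comp_aemeasurable hw.1.aemeasurable).div
      (Complex.measurable_ofReal.comp_aemeasurable hw.1.norm.aemeasurable)).aestronglyMeasurable
  have hnorm := h _ hmeas ⟨1, hbound⟩
  simp only [hsign] at hnorm
  rw [integral_complex_ofReal, Complex.ofReal_eq_zero,
    integral_eq_zero_iff_of_nonneg (fun _ => norm_nonneg _) hw.norm] at hnorm
  exact hnorm.mono fun x hx => norm_eq_zero.1 hx

theorem exists_bounded_integral_mul_eq [Finite κ] {w : κ → X → ℂ} {g : X → ℂ}
    (hw : ∀ i, Integrable (w i) μ) (hwg : ∀ i, Integrable (fun x => w i x * g x) μ) :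
    ∃ θ : X → ℂ, AEStronglyMeasurable θ μ ∧ (∃ C, ∀ x, ‖θ x‖ ≤ C) ∧
      ∀ i, ∫ x, w i x * θ x ∂μ = ∫ x, w i x * g x ∂μ := by
  classical
  have := Fintype.ofFinite κ
  change (fun i => ∫ x, w i x * g x ∂μ) ∈ boundedMomentSpace hw
  by_contra hmem
  obtain ⟨f, hf, hle⟩ := Submodule.exists_le_ker_of_notMem hmem
  have hsum : ∀ (η : X → ℂ), (∀ i, Integrable (fun x => w i x * η x) μ) →
      ∫ x, (∑ i, w i x * f fun j => if i = j then 1 else 0) * η x ∂μ =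
        f fun i => ∫ x, w i x * η x ∂μ := by
    intro η hη
    rw [LinearMap.pi_apply_eq_sum_univ f]
    simp only [Finset.sum_mul, mul_right_comm _ (f _)]
    rw [integral_finsetSum _ fun i _ => (hη i).mul_const _]
    simp only [integral_mul_const, smul_eq_mul]
  have hzero := ae_eq_zero_of_forall_bounded_integral_mul_eq_zero
    (integrable_finsetSum Finset.univ fun i _ =>
      (hw i).mul_const (f fun j => if i = j then 1 else 0))
    fun θ hθ ⟨C, hC⟩ => (hsum θ fun i => (hw i).mul_bdd hθ (.of_forall hC)).trans
      (hle ⟨θ, hθ, ⟨C, hC⟩, fun _ => rfl⟩)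
  refine hf ((hsum g hwg).symm.trans (integral_eq_zero_of_ae ?_))
  filter_upwards [hzero] with x hx
  rw [hx, Pi.zero_apply, zero_mul]

end BoundedMultiplier

theorem abs_pow_le_of_abs_sub_le {R x y : ℝ} {i j : ℕ} (hij : i ≤ j) (hy : R + 1 ≤ |y|)
    (hxy : |x - y| ≤ R) : |y| ^ i ≤ (R + 1) ^ j * |x| ^ j := by
  have hR : 0 ≤ R := (abs_nonneg _).trans hxy
  have htri : |y| ≤ |x| + R := by linarith [abs_sub_abs_le_abs_sub y x, abs_sub_comm x y]
  have hx : 1 ≤ |x| := by linarith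
  calc |y| ^ i ≤ |y| ^ j := pow_le_pow_right₀ (by linarith) hij
    _ ≤ ((R + 1) * |x|) ^ j := by gcongr; nlinarith [mul_nonneg hR (sub_nonneg.2 hx)]
    _ = (R + 1) ^ j * |x| ^ j := mul_pow _ _ _

theorem summable_integral_window {h : ℝ → ℝ} (hh : Integrable h) (R : ℕ) :
    Summable fun k : ℤ => ∫ x in (-R + k : ℝ)..(R + k), h x := by
  have hadj : ∀ k : ℤ, ∑ i ∈ Finset.range (2 * R), ∫ x in (-R + i + k : ℝ)..(-R + i + k + 1), h x =
      ∫ x in (-R + k : ℝ)..(R + k), h x := fun k => by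
    have := intervalIntegral.sum_integral_adjacent_intervals (μ := volume) (f := h)
      (a := fun i : ℕ => (-R + i + k : ℝ)) (n := 2 * R) fun i _ => hh.intervalIntegrable
    push_cast at this
    convert this using 2 <;> ring_nf
  simp only [← hadj]
  exact summable_sum fun i _ => (hh.hasSum_intervalIntegral (-R + i : ℝ)).summable

section ShiftSeries

variable {κ : Type*} [Fintype κ] {Φ : κ → ℝ → ℂ} {α : ℤ → κ → ℂ} {G : ℝ → ℂ}

/-- `G = ∑_k ∑_b α_k(b) Φ_b(· - k)` almost everywhere: the scalar, undilated form of
`IsTwoDirectionSeries`. -/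
def IsShiftSeries (Φ : κ → ℝ → ℂ) (α : ℤ → κ → ℂ) (G : ℝ → ℂ) : Prop :=
  ∀ᵐ x : ℝ, HasSum (fun k : ℤ => ∑ b, α k b * Φ b (x - k)) (G x)

namespace IsShiftSeries

theorem comp_add_int (h : IsShiftSeries Φ α G) (m : ℤ) :
    IsShiftSeries Φ (fun k => α (k + m)) fun x => G (x + m) := by
  filter_upwards [(measurePreserving_add_right volume (m : ℝ)).quasiMeasurePreserving.ae h]
    with x hx
  convert (Equiv.addRight m).hasSum_iff.2 hx using 2 with k
  simp only [Function.comp_apply, Equiv.coe_addRight, Int.cast_add, add_sub_add_right_eq_sub]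

theorem integral_eq (h : IsShiftSeries Φ α G) (hΦ : ∀ b, Integrable (Φ b))
    (hα : ∀ b, Summable fun k => α k b) :
    ∫ x, G x = ∑ b, (∑' k, α k b) * ∫ x, Φ b x := by
  have hint : ∀ k : ℤ, ∀ b, Integrable fun x : ℝ => α k b * Φ b (x - k) := fun k b =>
    ((hΦ b).comp_sub_right (k : ℝ)).const_mul (α k b)
  have hval : ∀ k : ℤ, ∫ x : ℝ, ∑ b, α k b * Φ b (x - k) = ∑ b, α k b * ∫ x, Φ b x := fun k => by
    simp only [integral_finsetSum _ fun b _ => hint k b, integral_const_mul,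
      integral_sub_right_eq_self]
  have hnorm : ∀ k : ℤ, ∫ x : ℝ, ‖∑ b, α k b * Φ b (x - k)‖ ≤ ∑ b, ‖α k b‖ * ∫ x, ‖Φ b x‖ :=
    fun k => calc
      _ ≤ ∫ x : ℝ, ∑ b, ‖α k b * Φ b (x - k)‖ :=
        integral_mono_of_nonneg (.of_forall fun _ => norm_nonneg _)
          (integrable_finsetSum _ fun b _ => (hint k b).norm) (.of_forall fun _ => norm_sum_le _ _)
      _ = ∑ b, ‖α k b‖ * ∫ x, ‖Φ b x‖ := by
        rw [integral_finsetSum _ fun b _ => (hint k b).norm]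
        refine Finset.sum_congr rfl fun b _ => ?_
        simp only [norm_mul, integral_const_mul]
        rw [integral_sub_right_eq_self fun x => ‖Φ b x‖]
  have hsum := hasSum_integral_of_summable_integral_norm
    (fun k => integrable_finsetSum Finset.univ fun b _ => hint k b)
    (.of_nonneg_of_le (fun _ => integral_nonneg fun _ => norm_nonneg _) hnorm
      (summable_sum fun b _ => (hα b).norm.mul_right _))
  simp only [hval] at hsum
  rw [integral_congr_ae (h.mono fun x hx => hx.tsum_eq.symm)]
  exact hsum.unique (hasSum_sum fun b _ => (hα b).hasSum.mul_right _)

theorem pow_mul (h : IsShiftSeries Φ α G) (j : ℕ) :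
    IsShiftSeries (fun (p : Fin (j + 1) × κ) y => (y : ℂ) ^ (p.1 : ℕ) * Φ p.2 y)
      (fun k p => (j.choose p.1 : ℂ) * ((k : ℂ) ^ (j - p.1) * α k p.2))
      fun x => (x : ℂ) ^ j * G x := by
  filter_upwards [h] with x hx
  refine (hx.mul_left ((x : ℂ) ^ j)).congr_fun fun k => ?_
  have hpow := add_pow ((x - k : ℝ) : ℂ) k j
  rw [← Fin.sum_univ_eq_sum_range (fun l =>
    ((x - k : ℝ) : ℂ) ^ l * (k : ℂ) ^ (j - l) * (j.choose l : ℂ)), Complex.ofReal_sub,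
    Complex.ofReal_intCast, sub_add_cancel] at hpow
  rw [hpow, Fintype.sum_prod_type, Finset.sum_mul_sum]
  push_cast
  exact Finset.sum_congr rfl fun l _ => Finset.sum_congr rfl fun b _ => by ring

theorem integral_pow_mul_eq (h : IsShiftSeries Φ α G) {j : ℕ}
    (hΦ : ∀ l ≤ j, ∀ b, Integrable fun y : ℝ => (y : ℂ) ^ l * Φ b y)
    (hα : ∀ i ≤ j, ∀ b, Summable fun k : ℤ => (k : ℂ) ^ i * α k b) :
    ∫ x : ℝ, (x : ℂ) ^ j * G x = ∑ l ∈ Finset.range (j + 1), (j.choose l : ℂ) *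
      ∑ b, (∑' k : ℤ, (k : ℂ) ^ (j - l) * α k b) * ∫ y : ℝ, (y : ℂ) ^ l * Φ b y := by
  rw [(h.pow_mul j).integral_eq (fun p => hΦ p.1 p.1.is_le p.2)
    fun p => (hα (j - p.1) (Nat.sub_le j p.1) p.2).mul_left _, Fintype.sum_prod_type,
    ← Fin.sum_univ_eq_sum_range (fun l => (j.choose l : ℂ) * ∑ b,
      (∑' k : ℤ, (k : ℂ) ^ (j - l) * α k b) * ∫ y : ℝ, (y : ℂ) ^ l * Φ b y)]
  simp only [tsum_mul_left, Finset.mul_sum, mul_assoc]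

theorem ae_eq_sum_on_Icc (h : IsShiftSeries Φ α G) {R : ℕ}
    (hsupp : ∀ b, Function.support (Φ b) ⊆ Set.Icc (-R : ℝ) R) :
    ∀ᵐ x ∂volume.restrict (Set.Icc (-R : ℝ) R),
      G x = ∑ m ∈ Finset.Icc (-(2 * R) : ℤ) (2 * R), ∑ b, α m b * Φ b (x - m) := by
  filter_upwards [ae_restrict_of_ae h, ae_restrict_mem measurableSet_Icc] with x hx hxR
  refine hx.unique (hasSum_sum_of_ne_finset_zero fun m hm =>
    Finset.sum_eq_zero fun b _ => mul_eq_zero_of_right _ ?_)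
  contrapose! hm
  obtain ⟨hl, hr⟩ := hsupp b hm
  refine Finset.mem_Icc.2 ⟨?_, ?_⟩ <;> rify <;> linarith [hxR.1, hxR.2]

end IsShiftSeries

end ShiftSeries

/-- A finite family of square-integrable functions supported in `[-R, R]` whose integer translates
are orthonormal. -/
structure OrthonormalShifts {κ : Type*} [DecidableEq κ] (Φ : κ → ℝ → ℂ) (R : ℕ) : Prop where
  memLp : ∀ b, MemLp (Φ b) 2
  support_subset : ∀ b, Function.support (Φ b) ⊆ Set.Icc (-R : ℝ) R
  integral_mul_star : ∀ p q : κ × ℤ,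
    ∫ x : ℝ, Φ p.1 (x - p.2) * star (Φ q.1 (x - q.2)) = if p = q then 1 else 0

namespace OrthonormalShifts

variable {κ : Type*} [DecidableEq κ] {Φ : κ → ℝ → ℂ} {R : ℕ}

theorem integrable_pow_mul (h : OrthonormalShifts Φ R) (j : ℕ) (b : κ) :
    Integrable fun x : ℝ => (x : ℂ) ^ j * Φ b x := by
  rw [← integrableOn_iff_integrable_of_support_subset
    ((Function.support_mul_subset_right _ _).trans (h.support_subset b))]
  exact (((h.memLp b).locallyIntegrable one_le_two).integrableOn_isCompact isCompact_Icc)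
    |>.continuousOn_mul (by fun_prop) isCompact_Icc

theorem integrable_pow_smul [Fintype κ] (h : OrthonormalShifts Φ R) (j : ℕ) :
    Integrable fun x : ℝ => (x ^ j) • fun b => Φ b x :=
  Integrable.of_eval fun b => by simpa using h.integrable_pow_mul j b

theorem integrable (h : OrthonormalShifts Φ R) (b : κ) : Integrable (Φ b) := by
  simpa using h.integrable_pow_mul 0 b

theorem exists_bounded_dual [Finite κ] (h : OrthonormalShifts Φ R) (b : κ) :
    ∃ θ : ℝ → ℂ, AEStronglyMeasurable θ (volume.restrict (Set.Icc (-R : ℝ) R)) ∧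
      (∃ C, ∀ x, ‖θ x‖ ≤ C) ∧ ∀ c, ∀ m ∈ Finset.Icc (-(2 * R) : ℤ) (2 * R),
        ∫ x in Set.Icc (-R : ℝ) R, Φ c (x - m) * θ x = if (c, m) = (b, 0) then 1 else 0 := by
  have hL2 : ∀ c (m : ℤ), MemLp (fun x : ℝ => Φ c (x - m)) 2 := fun c m =>
    (h.memLp c).comp_measurePreserving (measurePreserving_sub_right volume (m : ℝ))
  obtain ⟨θ, hθ, hC, hint⟩ := exists_bounded_integral_mul_eq
    (μ := volume.restrict (Set.Icc (-R : ℝ) R)) (g := fun x => star (Φ b x))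
    (w := fun (p : κ × Finset.Icc (-(2 * R) : ℤ) (2 * R)) x => Φ p.1 (x - (p.2 : ℤ)))
    (fun p => ((h.integrable p.1).comp_sub_right _).integrableOn)
    (fun p => ((hL2 p.1 p.2).integrable_mul (h.memLp b).star).integrableOn)
  refine ⟨θ, hθ, hC, fun c m hm => (hint (c, ⟨m, hm⟩)).trans ?_⟩
  rw [setIntegral_eq_integral_of_forall_compl_eq_zero fun x hx => ?_]
  · simpa using h.integral_mul_star (c, m) (b, 0)
  · rw [Function.notMem_support.1 (mt (@h.support_subset b x) hx), star_zero, mul_zero]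

section Coefficients

variable [Fintype κ] {α : ℤ → κ → ℂ} {G : ℝ → ℂ}

theorem exists_norm_coeff_zero_le (h : OrthonormalShifts Φ R) (b : κ) :
    ∃ C, ∀ α G, IsShiftSeries Φ α G → ‖α 0 b‖ ≤ C * ∫ x in (-R : ℝ)..R, ‖G x‖ := by
  obtain ⟨θ, hθ, ⟨C, hC⟩, hdual⟩ := h.exists_bounded_dual b
  refine ⟨C, fun α G hG => ?_⟩
  have hae := hG.ae_eq_sum_on_Icc h.support_subset
  have hΦ : ∀ c (m : ℤ), IntegrableOn (fun x : ℝ => Φ c (x - m)) (Set.Icc (-R) R) := fun c m =>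
    ((h.integrable c).comp_sub_right _).integrableOn
  have hGint : IntegrableOn G (Set.Icc (-R : ℝ) R) := Integrable.congr
    (integrable_finsetSum _ fun m _ => integrable_finsetSum _ fun c _ =>
      (hΦ c m).const_mul (α m c)) (hae.mono fun _ hx => hx.symm)
  have hcoeff : ∫ x in Set.Icc (-R : ℝ) R, G x * θ x = α 0 b := by
    rw [integral_congr_ae (hae.mono fun x hx => congrArg (· * θ x) hx)]
    simp only [Finset.sum_mul, mul_assoc]
    rw [integral_finsetSum _ fun m _ => integrable_finsetSum _ fun c _ =>
      ((hΦ c m).mul_bdd hθ (.of_forall hC)).const_mul (α m c)]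
    have hinner : ∀ m ∈ Finset.Icc (-(2 * R) : ℤ) (2 * R),
        ∫ x in Set.Icc (-R : ℝ) R, ∑ c, α m c * (Φ c (x - m) * θ x) =
          ∑ c, α m c * if (c, m) = (b, 0) then 1 else 0 := fun m hm => by
      rw [integral_finsetSum _ fun c _ => ((hΦ c m).mul_bdd hθ (.of_forall hC)).const_mul (α m c)]
      simp only [integral_const_mul]
      exact Finset.sum_congr rfl fun c _ => by rw [hdual c m hm]
    rw [Finset.sum_congr rfl hinner]
    simp [ite_and]
  rw [intervalIntegral.integral_of_le (by simp), ← integral_Icc_eq_integral_Ioc,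
    ← integral_const_mul, ← hcoeff]
  refine norm_integral_le_of_norm_le (hGint.norm.const_mul C) (.of_forall fun x => ?_)
  rw [norm_mul, mul_comm]
  exact mul_le_mul_of_nonneg_right (hC x) (norm_nonneg _)

theorem exists_norm_coeff_le (h : OrthonormalShifts Φ R) (b : κ) :
    ∃ C, ∀ α G, IsShiftSeries Φ α G → ∀ k : ℤ,
      ‖α k b‖ ≤ C * ∫ x in (-R + k : ℝ)..(R + k), ‖G x‖ := by
  obtain ⟨C, hC⟩ := h.exists_norm_coeff_zero_le b
  refine ⟨C, fun α G hG k => ?_⟩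
  simpa [intervalIntegral.integral_comp_add_right (fun x => ‖G x‖)] using hC _ _ (hG.comp_add_int k)

theorem summable_pow_mul_coeff (h : OrthonormalShifts Φ R) (hG : IsShiftSeries Φ α G) {i j : ℕ}
    (hij : i ≤ j) (hGj : Integrable fun x : ℝ => (x : ℂ) ^ j * G x) (b : κ) :
    Summable fun k : ℤ => (k : ℂ) ^ i * α k b := by
  obtain ⟨C, hC⟩ := h.exists_norm_coeff_le b
  refine Summable.of_norm_bounded_eventually
    ((summable_integral_window hGj.norm R).mul_left (|C| * (R + 1) ^ j)) ?_
  filter_upwards [(Set.finite_Icc (-R : ℤ) R).compl_mem_cofinite] with k hk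
  have hkR : (R + 1 : ℝ) ≤ |(k : ℝ)| := by
    rw [Set.mem_compl_iff, Set.mem_Icc, ← abs_le, not_le] at hk
    exact_mod_cast hk
  calc ‖(k : ℂ) ^ i * α k b‖ ≤ |(k : ℝ)| ^ i * (|C| * ∫ x in (-R + k : ℝ)..(R + k), ‖G x‖) := by
        rw [norm_mul, norm_pow, Complex.norm_intCast]
        gcongr
        refine (hC α G hG k).trans ?_
        gcongr
        · exact intervalIntegral.integral_nonneg (by gcongr; simp) fun _ _ => norm_nonneg _
        · exact le_abs_self C
    _ = |C| * ∫ x in (-R + k : ℝ)..(R + k), |(k : ℝ)| ^ i * ‖G x‖ := by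
        rw [intervalIntegral.integral_const_mul, mul_left_comm]
    _ ≤ |C| * ∫ x in (-R + k : ℝ)..(R + k), (R + 1) ^ j * ‖(x : ℂ) ^ j * G x‖ := by
        gcongr
        have hle : (-R + k : ℝ) ≤ R + k := by gcongr; simp
        simp only [intervalIntegral.integral_of_le hle]
        refine integral_mono_of_nonneg (.of_forall fun x => by positivity)
          (hGj.norm.const_mul _).integrableOn ?_
        filter_upwards [ae_restrict_mem measurableSet_Ioc] with x hx
        rw [norm_mul, norm_pow, Complex.norm_real, ← mul_assoc]
        refine mul_le_mul_of_nonneg_right (abs_pow_le_of_abs_sub_le hij hkR ?_) (norm_nonneg _)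
        exact abs_le.2 ⟨by linarith [hx.1], by linarith [hx.2]⟩
    _ = |C| * (R + 1) ^ j * ∫ x in (-R + k : ℝ)..(R + k), ‖(x : ℂ) ^ j * G x‖ := by
        rw [intervalIntegral.integral_const_mul, mul_assoc]

end Coefficients

end OrthonormalShifts

theorem norm_sq_starProjection_closure_span_range {𝕜 E ι : Type*} [RCLike 𝕜]
    [NormedAddCommGroup E] [InnerProductSpace 𝕜 E] [CompleteSpace E] {v : ι → E}
    (hv : Orthonormal 𝕜 v) {x : E} {S : Finset ι} (hS : ∀ i ∉ S, ⟪v i, x⟫_𝕜 = 0) :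
    ‖(Submodule.span 𝕜 (Set.range v)).topologicalClosure.starProjection x‖ ^ 2 =
      ∑ i ∈ S, ‖⟪v i, x⟫_𝕜‖ ^ 2 := by
  classical
  set K := Submodule.span 𝕜 (Set.range v)
  set p := ∑ i ∈ S, ⟪v i, x⟫_𝕜 • v i
  have hpK : p ∈ K := Submodule.sum_mem _ fun i _ =>
    Submodule.smul_mem _ _ (Submodule.subset_span ⟨i, rfl⟩)
  have hvp : ∀ i, ⟪v i, x - p⟫_𝕜 = 0 := fun i => by
    by_cases hi : i ∈ S
    · rw [inner_sub_right, hv.inner_right_sum _ hi, sub_self]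
    · simp [inner_sub_right, hS i hi, p, inner_sum, inner_smul_right, orthonormal_iff_ite.1 hv, hi]
  have hK : K ≤ (𝕜 ∙ (x - p))ᗮ := Submodule.span_le.2 <| Set.range_subset_iff.2 fun i =>
    Submodule.mem_orthogonal_singleton_iff_inner_left.2 (hvp i)
  have hxp : x - p ∈ K.topologicalClosureᗮ := by
    rw [Submodule.orthogonal_closure]
    exact (Submodule.mem_orthogonal _ _).2 fun u hu =>
      Submodule.mem_orthogonal_singleton_iff_inner_left.1 (hK hu)
  rw [Submodule.eq_starProjection_of_mem_orthogonal (K.le_topologicalClosure hpK) hxp]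
  have hnorm : ((‖p‖ ^ 2 : ℝ) : 𝕜) = ∑ i ∈ S, ((‖⟪v i, x⟫_𝕜‖ ^ 2 : ℝ) : 𝕜) := by
    rw [RCLike.ofReal_pow, ← inner_self_eq_norm_sq_to_K, hv.inner_sum]
    simp only [RCLike.conj_mul, RCLike.ofReal_pow]
  exact_mod_cast hnorm

theorem abs_sum_Icc_le_of_eq_zero {a : ℤ → ℝ} {B : ℝ} {N R : ℕ}
    (hzero : ∀ k : ℤ, R ≤ k → k ≤ N - R → a k = 0) (hbdd : ∀ k, |a k| ≤ B) :
    |∑ k ∈ Finset.Icc (-R : ℤ) (N + R), a k| ≤ 4 * R * B := by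
  set U : Finset ℤ := Finset.Ico (-R : ℤ) R ∪ Finset.Ioc (N - R : ℤ) (N + R) with hUdef
  have hU : U.card ≤ 4 * R := by
    refine (Finset.card_union_le _ _).trans ?_
    rw [Int.card_Ico, Int.card_Ioc]
    omega
  rw [← Finset.sum_subset (s₁ := U) (fun k hk => ?_) fun k hk hkU => ?_]
  · calc |∑ k ∈ U, a k| ≤ ∑ k ∈ U, |a k| := Finset.abs_sum_le_sum_abs _ _
      _ ≤ U.card * B := by simpa using Finset.sum_le_card_nsmul U _ B fun k _ => hbdd k
      _ ≤ 4 * R * B := by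
        gcongr
        · exact (abs_nonneg _).trans (hbdd 0)
        · exact_mod_cast hU
  · simp only [hUdef, Finset.mem_union, Finset.mem_Ico, Finset.mem_Ioc, Finset.mem_Icc] at hk ⊢
    omega
  · simp only [hUdef, Finset.mem_union, Finset.mem_Ico, Finset.mem_Ioc, Finset.mem_Icc] at hk hkU
    exact hzero k (by omega) (by omega)

theorem tendsto_inv_mul_sum_of_eq_const {a : ℕ → ℤ → ℝ} {A B : ℝ} {R : ℕ}
    (hconst : ∀ (N : ℕ) (k : ℤ), R ≤ k → k ≤ N - R → a N k = A)
    (hbdd : ∀ N k, |a N k - A| ≤ B) :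
    Filter.Tendsto (fun N : ℕ => (N : ℝ)⁻¹ * ∑ k ∈ Finset.Icc (-R : ℤ) (N + R), a N k)
      Filter.atTop (nhds A) := by
  rw [tendsto_iff_norm_sub_tendsto_zero]
  refine squeeze_zero' (.of_forall fun _ => norm_nonneg _) ?_
    (tendsto_const_div_atTop_nhds_zero_nat ((2 * R + 1) * |A| + 4 * R * B))
  filter_upwards [Filter.eventually_gt_atTop 0] with N hN
  have hcard : ((Finset.Icc (-R : ℤ) (N + R)).card : ℝ) = N + 2 * R + 1 := by
    rw [Int.card_Icc]
    exact_mod_cast (by omega : (N + R + 1 - -R : ℤ).toNat = N + 2 * R + 1)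
  have hsplit : (N : ℝ)⁻¹ * ∑ k ∈ Finset.Icc (-R : ℤ) (N + R), a N k - A =
      ((2 * R + 1) * A + ∑ k ∈ Finset.Icc (-R : ℤ) (N + R), (a N k - A)) / N := by
    rw [Finset.sum_sub_distrib, Finset.sum_const, nsmul_eq_mul, hcard]
    field_simp
    ring
  have hboundary := abs_sum_Icc_le_of_eq_zero (a := fun k => a N k - A)
    (fun k hk hkN => sub_eq_zero.2 (hconst N k hk hkN)) (hbdd N)
  rw [hsplit, Real.norm_eq_abs, abs_div, Nat.abs_cast]
  gcongr
  refine (abs_add_le _ _).trans (add_le_add ?_ hboundary)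
  rw [abs_mul, abs_of_nonneg (by positivity)]

/-- The indicator function of `[0, 1]` in `L²(ℝ)`: a unit vector whose projections onto the spaces
`V_n` can be computed explicitly. -/
noncomputable def unitIndicator : Lp ℂ 2 (volume : Measure ℝ) :=
  indicatorConstLp 2 (measurableSet_Icc (a := (0 : ℝ)) (b := 1)) (by simp) (1 : ℂ)

theorem norm_unitIndicator : ‖unitIndicator‖ = 1 := by
  rw [unitIndicator, norm_indicatorConstLp (by simp) (by simp)]
  simp

namespace OrthonormalShifts

variable {κ : Type*} [DecidableEq κ] {Φ : κ → ℝ → ℂ} {R : ℕ}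

theorem intervalIntegral_eq_integral (h : OrthonormalShifts Φ R) (b : κ) {s t : ℝ} (hs : s ≤ -R)
    (ht : R ≤ t) : ∫ y in s..t, Φ b y = ∫ y, Φ b y := by
  rw [intervalIntegral.integral_of_le (hs.trans ((neg_nonpos.2 R.cast_nonneg).trans
    (R.cast_nonneg.trans ht))), ← integral_Icc_eq_integral_Ioc]
  exact setIntegral_eq_integral_of_forall_compl_eq_zero fun x hx =>
    Function.notMem_support.1 fun hsupp => hx (Set.Icc_subset_Icc hs ht (h.support_subset b hsupp))

theorem intervalIntegral_eq_zero (h : OrthonormalShifts Φ R) (b : κ) {s t : ℝ}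
    (hst : Disjoint (Set.uIcc s t) (Set.Icc (-R : ℝ) R)) : ∫ y in s..t, Φ b y = 0 := by
  rw [intervalIntegral.integral_congr (g := fun _ => 0) fun y hy =>
    Function.notMem_support.1 fun hsupp => hst.le_bot ⟨hy, h.support_subset b hsupp⟩]
  exact intervalIntegral.integral_zero

theorem norm_intervalIntegral_le (h : OrthonormalShifts Φ R) (b : κ) (s t : ℝ) :
    ‖∫ y in s..t, Φ b y‖ ≤ ∫ y, ‖Φ b y‖ :=
  (intervalIntegral.norm_integral_le_integral_norm_uIoc).trans
    (setIntegral_le_integral (h.integrable b).norm (.of_forall fun _ => norm_nonneg _))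

theorem memLp_dilate (h : OrthonormalShifts Φ R) {c : ℝ} (hc : 0 < c) (p : κ × ℤ) :
    MemLp (fun x : ℝ => (Real.sqrt c : ℂ) * Φ p.1 (c * x - p.2)) 2 := by
  refine MemLp.const_mul (MemLp.comp_of_map (f := fun x => c * x)
    (g := fun y => Φ p.1 (y - p.2)) ?_ (by fun_prop)) _
  rw [Real.map_volume_mul_left hc.ne']
  exact ((h.memLp p.1).comp_measurePreserving
    (measurePreserving_sub_right volume (p.2 : ℝ))).smul_measure ENNReal.ofReal_ne_top

/-- The functions `√c Φ_b(c x - k)` as elements of `L²(ℝ)`. -/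
noncomputable def dilateLp (h : OrthonormalShifts Φ R) {c : ℝ} (hc : 0 < c) (p : κ × ℤ) :
    Lp ℂ 2 (volume : Measure ℝ) :=
  (h.memLp_dilate hc p).toLp _

/-- The closed subspace spanned by the functions `Φ_b(c x - k)`, which is `V_n` for `c = d ^ n`. -/
noncomputable abbrev dilateSpace (h : OrthonormalShifts Φ R) {c : ℝ} (hc : 0 < c) :
    Submodule ℂ (Lp ℂ 2 (volume : Measure ℝ)) :=
  (Submodule.span ℂ (Set.range (h.dilateLp hc))).topologicalClosure

theorem coeFn_dilateLp (h : OrthonormalShifts Φ R) {c : ℝ} (hc : 0 < c) (p : κ × ℤ) :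
    h.dilateLp hc p =ᵐ[volume] fun x : ℝ => (Real.sqrt c : ℂ) * Φ p.1 (c * x - p.2) :=
  (h.memLp_dilate hc p).coeFn_toLp

theorem orthonormal_dilateLp (h : OrthonormalShifts Φ R) {c : ℝ} (hc : 0 < c) :
    Orthonormal ℂ (h.dilateLp hc) := by
  refine orthonormal_iff_ite.2 fun p q => ?_
  have hinner : ⟪h.dilateLp hc p, h.dilateLp hc q⟫_ℂ =
      ∫ x : ℝ, (c : ℂ) * (Φ q.1 (c * x - q.2) * star (Φ p.1 (c * x - p.2))) := by
    rw [L2.inner_def]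
    refine integral_congr_ae ?_
    filter_upwards [h.coeFn_dilateLp hc p, h.coeFn_dilateLp hc q] with x hp hq
    rw [hp, hq, RCLike.inner_apply, map_mul, Complex.conj_ofReal, mul_mul_mul_comm,
      ← Complex.ofReal_mul, Real.mul_self_sqrt hc.le, starRingEnd_apply]
  rw [hinner, integral_const_mul, Measure.integral_comp_mul_left
    (fun y => Φ q.1 (y - q.2) * star (Φ p.1 (y - p.2))) c, h.integral_mul_star,
    abs_of_pos (inv_pos.2 hc), Complex.real_smul, ← mul_assoc, ← Complex.ofReal_mul,
    mul_inv_cancel₀ hc.ne', Complex.ofReal_one, one_mul]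
  simp only [eq_comm]

theorem dilateSpace_eq (h : OrthonormalShifts Φ R) {c : ℝ} (hc : 0 < c) :
    h.dilateSpace hc = (Submodule.span ℂ {g : Lp ℂ 2 (volume : Measure ℝ) | ∃ p : κ × ℤ,
      g =ᵐ[volume] fun x : ℝ => Φ p.1 (c * x - p.2)}).topologicalClosure := by
  have hs : (Real.sqrt c : ℂ) ≠ 0 := by exact_mod_cast (Real.sqrt_pos.2 hc).ne'
  have hcoe : ∀ p, ⇑((Real.sqrt c : ℂ)⁻¹ • h.dilateLp hc p) =ᵐ[volume]
      fun x : ℝ => Φ p.1 (c * x - p.2) := fun p => by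
    filter_upwards [h.coeFn_dilateLp hc p, Lp.coeFn_smul (Real.sqrt c : ℂ)⁻¹ (h.dilateLp hc p)]
      with x hx hsmul
    rw [hsmul, Pi.smul_apply, hx, smul_eq_mul, inv_mul_cancel_left₀ hs]
  have hset : {g : Lp ℂ 2 (volume : Measure ℝ) | ∃ p : κ × ℤ,
      g =ᵐ[volume] fun x : ℝ => Φ p.1 (c * x - p.2)} =
      (Real.sqrt c : ℂ)⁻¹ • Set.range (h.dilateLp hc) := by
    rw [← Set.image_smul, ← Set.range_comp]
    ext g
    exact exists_congr fun p =>
      ⟨fun hg => Lp.ext ((hcoe p).trans hg.symm), fun hg => hg ▸ hcoe p⟩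
  rw [hset, Submodule.span_smul_eq_of_isUnit _ _ (inv_ne_zero hs).isUnit]

theorem norm_sq_inner_unitIndicator (h : OrthonormalShifts Φ R) {c : ℝ} (hc : 0 < c)
    (p : κ × ℤ) : ‖⟪h.dilateLp hc p, unitIndicator⟫_ℂ‖ ^ 2 =
      c⁻¹ * ‖∫ y in (-p.2 : ℝ)..(c - p.2), Φ p.1 y‖ ^ 2 := by
  rw [norm_inner_symm, unitIndicator, L2.inner_indicatorConstLp_one,
    setIntegral_congr_ae measurableSet_Icc
      ((h.coeFn_dilateLp hc p).mono fun x hx _ => hx), integral_const_mul,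
    integral_Icc_eq_integral_Ioc, ← intervalIntegral.integral_of_le zero_le_one,
    intervalIntegral.integral_comp_mul_sub _ hc.ne', norm_mul, norm_smul, mul_pow, mul_pow,
    Complex.norm_real, Real.norm_of_nonneg (Real.sqrt_nonneg _), Real.sq_sqrt hc.le,
    Real.norm_of_nonneg (inv_pos.2 hc).le, mul_zero, mul_one, zero_sub]
  field_simp

theorem tendsto_inv_mul_sum_norm_sq_intervalIntegral (h : OrthonormalShifts Φ R) (b : κ) :
    Filter.Tendsto (fun N : ℕ => (N : ℝ)⁻¹ * ∑ k ∈ Finset.Icc (-R : ℤ) (N + R),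
      ‖∫ y in (-k : ℝ)..(N - k), Φ b y‖ ^ 2) Filter.atTop (nhds (‖∫ y, Φ b y‖ ^ 2)) := by
  refine tendsto_inv_mul_sum_of_eq_const (B := (∫ y, ‖Φ b y‖) ^ 2) (fun N k hk hkN => ?_)
    fun N k => abs_sub_le_of_nonneg_of_le (by positivity) ?_ (by positivity) ?_
  · rw [h.intervalIntegral_eq_integral b] <;> rify at hk hkN <;> linarith
  · gcongr
    exact h.norm_intervalIntegral_le b _ _
  · gcongr
    exact norm_integral_le_integral_norm _

variable [Fintype κ]

theorem norm_sq_starProjection_unitIndicator (h : OrthonormalShifts Φ R) {N : ℕ}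
    (hN : (0 : ℝ) < N) :
    ‖(h.dilateSpace hN).starProjection unitIndicator‖ ^ 2 = ∑ b, (N : ℝ)⁻¹ *
      ∑ k ∈ Finset.Icc (-R : ℤ) (N + R), ‖∫ y in (-k : ℝ)..(N - k), Φ b y‖ ^ 2 := by
  rw [norm_sq_starProjection_closure_span_range (h.orthonormal_dilateLp hN)
    (S := Finset.univ ×ˢ Finset.Icc (-R : ℤ) (N + R)) fun p hp => ?_, Finset.sum_product]
  · simp only [h.norm_sq_inner_unitIndicator, Finset.mul_sum]
  · rw [← norm_eq_zero, ← sq_eq_zero_iff, h.norm_sq_inner_unitIndicator,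
      h.intervalIntegral_eq_zero, norm_zero, zero_pow two_ne_zero, mul_zero]
    rw [Set.uIcc_of_le (by linarith), Set.disjoint_left]
    rintro y ⟨hy1, hy2⟩ ⟨hR1, hR2⟩
    refine hp (Finset.mem_product.2 ⟨Finset.mem_univ _, Finset.mem_Icc.2 ⟨?_, ?_⟩⟩) <;>
      rify <;> linarith

theorem sum_norm_sq_integral_eq_one (h : OrthonormalShifts Φ R) {c : ℕ → ℕ}
    (hc : ∀ n, (0 : ℝ) < c n) (hlim : Filter.Tendsto c Filter.atTop Filter.atTop)
    (hmono : Monotone fun n => h.dilateSpace (hc n))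
    (hdense : (⨆ n, h.dilateSpace (hc n)).topologicalClosure = ⊤) :
    ∑ b, ‖∫ y, Φ b y‖ ^ 2 = 1 := by
  have hproj := (Submodule.starProjection_tendsto_self (fun n => h.dilateSpace (hc n)) hmono
    unitIndicator hdense.ge).norm.pow 2
  simp only [h.norm_sq_starProjection_unitIndicator, norm_unitIndicator, one_pow] at hproj
  exact tendsto_nhds_unique ((tendsto_finsetSum _ fun b _ =>
    h.tendsto_inv_mul_sum_norm_sq_intervalIntegral b).comp hlim) hproj

end OrthonormalShifts

section Doubled

variable {r d j : ℕ} {φ f : ℝ → Fin r → ℂ}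

theorem memLp_doubled (hφ : ∀ i, MemLp (fun x => φ x i) 2) :
    ∀ b, MemLp (fun x => doubled φ x b) 2
  | .inl i => hφ i
  | .inr i => (hφ i).comp_measurePreserving (Measure.measurePreserving_neg volume)

theorem exists_support_doubled_subset_Icc (hsupp : HasCompactSupport φ) :
    ∃ R : ℕ, ∀ b, Function.support (fun x => doubled φ x b) ⊆ Set.Icc (-R : ℝ) R := by
  obtain ⟨R₀, hR₀⟩ := hsupp.isCompact.isBounded.exists_norm_le
  obtain ⟨R, hR⟩ := exists_nat_ge R₀
  have hle : ∀ (x : ℝ) i, φ x i ≠ 0 → |x| ≤ R := fun x i hx =>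
    (hR₀ x (subset_tsupport φ fun h0 => hx (congrFun h0 i))).trans hR
  refine ⟨R, fun b x hx => abs_le.1 ?_⟩
  rcases b with i | i
  · exact hle x i hx
  · exact abs_neg x ▸ hle (-x) i hx

theorem IsOrthogonal.integral_doubled_mul_star (horth : IsOrthogonal φ)
    (p q : (Fin r ⊕ Fin r) × ℤ) :
    ∫ x : ℝ, doubled φ (x - p.2) p.1 * star (doubled φ (x - q.2) q.1) =
      if p = q then 1 else 0 := by
  have hsame : ∀ i i' (k l : ℤ), ∫ x : ℝ, φ (x - k) i * star (φ (x - l) i') =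
      if i = i' ∧ k = l then 1 else 0 := fun i i' k l => by
    refine (congrFun (congrFun (horth.same k l) i) i').trans ?_
    split_ifs <;> simp_all [Matrix.one_apply]
  have hopp : ∀ i i' (k l : ℤ), ∫ x : ℝ, φ (x - k) i * star (φ (-(x - l)) i') = 0 :=
    fun i i' k l => by
      simp only [neg_sub]
      exact congrFun (congrFun (horth.opposite k l) i) i'
  obtain ⟨i | i, k⟩ := p <;> obtain ⟨i' | i', l⟩ := q <;>
    simp only [doubled, Sum.elim_inl, Sum.elim_inr, Prod.mk.injEq, Sum.inl.injEq, Sum.inr.injEq,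
      reduceCtorEq, false_and, if_false]
  · exact hsame i i' k l
  · exact hopp i i' k l
  · rw [← star_eq_zero, ← hopp i' i l k, ← starRingEnd_apply, ← integral_conj]
    simp only [map_mul, starRingEnd_apply, star_star, mul_comm]
  · rw [← integral_neg_eq_self]
    simpa only [neg_inj, Int.cast_neg, sub_neg_eq_add, neg_sub, add_comm] using
      hsame i i' (-k) (-l)

theorem IsOrthogonal.exists_orthonormalShifts (horth : IsOrthogonal φ)
    (hφ : ∀ i, MemLp (fun x => φ x i) 2) (hsupp : HasCompactSupport φ) :
    ∃ R, OrthonormalShifts (fun b x => doubled φ x b) R :=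
  let ⟨R, hR⟩ := exists_support_doubled_subset_Icc hsupp
  ⟨R, memLp_doubled hφ, hR, horth.integral_doubled_mul_star⟩

theorem scaleSpace_natCast {R : ℕ} (h : OrthonormalShifts (fun b x => doubled φ x b) R) (n : ℕ)
    (hc : (0 : ℝ) < (d ^ n : ℕ)) : scaleSpace d φ n = h.dilateSpace hc := by
  rw [h.dilateSpace_eq, scaleSpace]
  congr 3 with g
  simp [doubled, exists_or]

theorem continuousMoment_apply {ι : Type*} [Fintype ι] {f : ℝ → ι → ℂ}
    (hf : Integrable fun x : ℝ => (x ^ j) • f x) (a : ι) :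
    continuousMoment f j a = ∫ x : ℝ, (x : ℂ) ^ j * f x a := by
  rw [continuousMoment, eval_integral fun i => hf.eval i]
  simp only [Pi.smul_apply, Complex.real_smul, Complex.ofReal_pow]

theorem integrable_pow_smul_doubled (hf : Integrable fun x : ℝ => (x ^ j) • f x) :
    Integrable fun x : ℝ => (x ^ j) • doubled f x := by
  refine Integrable.of_eval fun
    | .inl i => hf.eval i
    | .inr i => ((hf.eval i).comp_neg.const_mul ((-1 : ℂ) ^ j)).congr (.of_forall fun x => ?_)
  simp only [doubled, Pi.smul_apply, Sum.elim_inr, Complex.real_smul]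
  push_cast
  rw [← mul_assoc, ← mul_pow, neg_one_mul, neg_neg]

theorem continuousMoment_eq_upperHalf (hf : Integrable fun x : ℝ => (x ^ j) • f x) :
    continuousMoment f j = upperHalf (continuousMoment (doubled f) j) := by
  funext i
  rw [upperHalf, continuousMoment_apply (integrable_pow_smul_doubled hf),
    continuousMoment_apply hf]
  rfl

theorem GeneratesMRA.star_dotProduct_continuousMoment_zero (hφ : GeneratesMRA d φ) (hd : 2 ≤ d)
    {R : ℕ} (h : OrthonormalShifts (fun b x => doubled φ x b) R) :
    dotProduct (star (continuousMoment (doubled φ) 0)) (continuousMoment (doubled φ) 0) = 1 := by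
  have hc : ∀ n : ℕ, (0 : ℝ) < (d ^ n : ℕ) := fun n => by
    exact_mod_cast pow_pos (by omega : 0 < d) n
  have hmono : Monotone (scaleSpace d φ) := monotone_int_of_le_succ hφ.nested
  have hsup : ⨆ n : ℤ, scaleSpace d φ n ≤ ⨆ n : ℕ, scaleSpace d φ n :=
    iSup_le fun n => le_iSup_of_le n.toNat (hmono (Int.self_le_toNat n))
  have hone := h.sum_norm_sq_integral_eq_one hc
    (tendsto_pow_atTop_atTop_of_one_lt (by omega : 1 < d))
    (by simp only [← scaleSpace_natCast]; exact hmono.comp Nat.mono_cast)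
    (by simpa only [← scaleSpace_natCast] using
      top_unique (hφ.dense.ge.trans (Submodule.topologicalClosure_mono hsup)))
  have hm : ∀ b, continuousMoment (doubled φ) 0 b = ∫ x, doubled φ x b := fun b => by
    rw [continuousMoment_apply (h.integrable_pow_smul 0)]
    simp only [pow_zero, one_mul]
  simp only [dotProduct, Pi.star_apply, hm]
  rw [← Complex.ofReal_one, ← hone, Complex.ofReal_sum]
  exact Finset.sum_congr rfl fun b _ => by
    simpa using RCLike.conj_mul (∫ x : ℝ, doubled φ x b)

end Doubled

section Series

variable {c : ℝ} {j : ℕ} {g : ℝ → ℂ}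

theorem integrable_pow_mul_comp_div (hc : c ≠ 0) (hg : Integrable fun x : ℝ => (x : ℂ) ^ j * g x) :
    Integrable fun x : ℝ => (x : ℂ) ^ j * g (x / c) := by
  refine ((hg.comp_div hc).const_mul ((c : ℂ) ^ j)).congr (.of_forall fun x => ?_)
  simp only [Complex.ofReal_div]
  rw [← mul_assoc, ← mul_pow, mul_div_cancel₀ _ (Complex.ofReal_ne_zero.2 hc)]

theorem integral_pow_mul_comp_div (hc : 0 < c) :
    ∫ x : ℝ, (x : ℂ) ^ j * g (x / c) = (c : ℂ) ^ (j + 1) * ∫ x : ℝ, (x : ℂ) ^ j * g x := by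
  have hscale := Measure.integral_comp_div (fun x : ℝ => (x : ℂ) ^ j * g x) c
  rw [abs_of_pos hc, Complex.real_smul] at hscale
  rw [pow_succ, mul_assoc, ← hscale, ← integral_const_mul]
  refine integral_congr_ae (.of_forall fun x => ?_)
  simp only [Complex.ofReal_div]
  rw [← mul_assoc, ← mul_pow, mul_div_cancel₀ _ (Complex.ofReal_ne_zero.2 hc.ne')]

variable {r d : ℕ} {Ap Am : ℤ → Matrix (Fin r) (Fin r) ℝ} {φ f : ℝ → Fin r → ℂ}

/-- The matrices `√d [[A_k^+, A_k^-], [A_{-k}^-, A_{-k}^+]]`, which are the coefficients of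
`[f(x/d), f(-x/d)]^T` as a series in the translates of `[φ(x), φ(-x)]^T`. -/
noncomputable def blockCoeff (d : ℕ) (Ap Am : ℤ → Matrix (Fin r) (Fin r) ℝ) (k : ℤ) :
    Matrix (Fin r ⊕ Fin r) (Fin r ⊕ Fin r) ℝ :=
  Real.sqrt d • Matrix.fromBlocks (Ap k) (Am k) (Am (-k)) (Ap (-k))

theorem IsTwoDirectionSeries.isShiftSeries (hf : IsTwoDirectionSeries d Ap Am φ f) (hd : 0 < d)
    (a : Fin r ⊕ Fin r) :
    IsShiftSeries (fun b x => doubled φ x b) (fun k b => (blockCoeff d Ap Am k a b : ℂ))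
      fun x => doubled f (x / d) a := by
  have hd0 : (d : ℝ) ≠ 0 := Nat.cast_ne_zero.2 hd.ne'
  have hdiv : ∀ᵐ x : ℝ, HasSum (fun k : ℤ => Real.sqrt d •
      ((toComplex (Ap k)).mulVec (φ (x - k)) + (toComplex (Am k)).mulVec (φ (k - x))))
      (f (x / d)) := by
    filter_upwards [(Measure.quasiMeasurePreserving_smul volume (inv_ne_zero hd0)).ae hf]
      with x hx
    simpa only [smul_eq_mul, inv_mul_eq_div, mul_div_cancel₀ _ hd0] using hx
  rcases a with i | i
  · filter_upwards [hdiv] with x hx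
    refine (Pi.hasSum.1 hx i).congr_fun fun k => ?_
    simp [doubled, blockCoeff, toComplex, Matrix.mulVec, dotProduct, mul_assoc, Finset.mul_sum]
  · filter_upwards [(Measure.measurePreserving_neg volume).quasiMeasurePreserving.ae hdiv]
      with x hx
    rw [doubled, Sum.elim_inr, ← neg_div]
    refine ((Equiv.neg ℤ).hasSum_iff.2 (Pi.hasSum.1 hx i)).congr_fun fun k => ?_
    have hplus : -x - ((-k : ℤ) : ℝ) = -(x - k) := by push_cast; ring
    have hminus : ((-k : ℤ) : ℝ) - -x = x - k := by push_cast; ring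
    simp only [Function.comp_apply, Equiv.neg_apply, hplus, hminus]
    simp [doubled, blockCoeff, toComplex, Matrix.mulVec, dotProduct, mul_assoc, Finset.mul_sum,
      add_comm]

theorem hasSum_matrix_iff {m n X : Type*} {F : X → Matrix m n ℝ} {M : Matrix m n ℝ} :
    HasSum F M ↔ ∀ a b, HasSum (fun k => F k a b) (M a b) :=
  Pi.hasSum.trans (forall_congr' fun _ => Pi.hasSum)

theorem pow_mul_blockCoeff (d : ℕ) (Ap Am : ℤ → Matrix (Fin r) (Fin r) ℝ) (j : ℕ) (k : ℤ)
    (a b : Fin r ⊕ Fin r) : (k : ℂ) ^ j * (blockCoeff d Ap Am k a b : ℂ) =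
      (Real.sqrt d * discreteMomentTerm Ap Am j k a b : ℝ) := by
  simp only [discreteMomentTerm, blockCoeff, Matrix.smul_apply, smul_eq_mul]
  push_cast
  ring

theorem summable_discreteMomentTerm_of_blockCoeff (hd : 0 < d)
    (h : ∀ a b, Summable fun k : ℤ => (k : ℂ) ^ j * (blockCoeff d Ap Am k a b : ℂ)) :
    Summable (discreteMomentTerm Ap Am j) := by
  have hs : Real.sqrt d ≠ 0 := (Real.sqrt_pos.2 (Nat.cast_pos.2 hd)).ne'
  refine ⟨fun a b => ∑' k : ℤ, discreteMomentTerm Ap Am j k a b,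
    hasSum_matrix_iff.2 fun a b => Summable.hasSum ?_⟩
  simpa only [pow_mul_blockCoeff, Complex.summable_ofReal, summable_mul_left_iff hs] using h a b

theorem tsum_pow_mul_blockCoeff (h : Summable (discreteMomentTerm Ap Am j))
    (a b : Fin r ⊕ Fin r) : ∑' k : ℤ, (k : ℂ) ^ j * (blockCoeff d Ap Am k a b : ℂ) =
      d * discreteMoment d Ap Am j a b := by
  simp only [pow_mul_blockCoeff, ← Complex.ofReal_tsum, tsum_mul_left,
    (hasSum_matrix_iff.1 h.hasSum a b).tsum_eq, discreteMoment, toComplex, Matrix.map_apply,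
    Matrix.smul_apply, smul_eq_mul]
  rw [← Complex.ofReal_natCast, ← Complex.ofReal_mul, ← mul_assoc, mul_one_div, Real.div_sqrt]

namespace IsTwoDirectionSeries

variable {R : ℕ}

theorem summable_pow_mul_blockCoeff (hf : IsTwoDirectionSeries d Ap Am φ f) (hd : 0 < d)
    (h : OrthonormalShifts (fun b x => doubled φ x b) R)
    (hj : Integrable fun x : ℝ => (x ^ j) • f x) {i : ℕ} (hij : i ≤ j) (a b : Fin r ⊕ Fin r) :
    Summable fun k : ℤ => (k : ℂ) ^ i * (blockCoeff d Ap Am k a b : ℂ) := by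
  have hja : Integrable fun x : ℝ => (x : ℂ) ^ j * doubled f x a := by
    simpa using (integrable_pow_smul_doubled hj).eval a
  exact h.summable_pow_mul_coeff (hf.isShiftSeries hd a) hij
    (integrable_pow_mul_comp_div (Nat.cast_ne_zero.2 hd.ne') hja) b

theorem summable_discreteMomentTerm (hf : IsTwoDirectionSeries d Ap Am φ f) (hd : 0 < d)
    (h : OrthonormalShifts (fun b x => doubled φ x b) R)
    (hj : Integrable fun x : ℝ => (x ^ j) • f x) {i : ℕ} (hij : i ≤ j) :
    Summable (discreteMomentTerm Ap Am i) :=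
  summable_discreteMomentTerm_of_blockCoeff hd (hf.summable_pow_mul_blockCoeff hd h hj hij)

theorem continuousMoment_doubled (hf : IsTwoDirectionSeries d Ap Am φ f) (hd : 0 < d)
    (h : OrthonormalShifts (fun b x => doubled φ x b) R)
    (hj : Integrable fun x : ℝ => (x ^ j) • f x) :
    continuousMoment (doubled f) j = ((d : ℂ) ^ j)⁻¹ • ∑ l ∈ Finset.range (j + 1),
      (j.choose l : ℂ) •
        (discreteMoment d Ap Am (j - l)).mulVec (continuousMoment (doubled φ) l) := by
  have hd0 : (d : ℂ) ≠ 0 := Nat.cast_ne_zero.2 hd.ne'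
  have hφ : ∀ l b, continuousMoment (doubled φ) l b = ∫ x : ℝ, (x : ℂ) ^ l * doubled φ x b :=
    fun l => continuousMoment_apply (h.integrable_pow_smul l)
  funext a
  have hmom := (hf.isShiftSeries hd a).integral_pow_mul_eq
    (fun l _ => h.integrable_pow_mul l)
    fun i hi => hf.summable_pow_mul_blockCoeff hd h hj hi a
  rw [integral_pow_mul_comp_div (g := fun x => doubled f x a) (Nat.cast_pos.2 hd),
    ← continuousMoment_apply (integrable_pow_smul_doubled hj), Complex.ofReal_natCast, pow_succ',
    mul_assoc] at hmom
  rw [Pi.smul_apply, smul_eq_mul, eq_inv_mul_iff_mul_eq₀ (pow_ne_zero j hd0)]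
  refine mul_left_cancel₀ hd0 (hmom.trans ?_)
  simp only [Finset.sum_apply, Pi.smul_apply, smul_eq_mul, Matrix.mulVec, dotProduct,
    Finset.mul_sum, hφ, tsum_pow_mul_blockCoeff
      (hf.summable_discreteMomentTerm hd h hj (Nat.sub_le j _))]
  exact Finset.sum_congr rfl fun l _ => Finset.sum_congr rfl fun b _ => by ring

end IsTwoDirectionSeries

end Series

section LinearAlgebra

variable {n : Type*} [Fintype n]

theorem star_smul_dotProduct_smul (c : ℂ) (v : n → ℂ) :
    dotProduct (star (c • v)) (c • v) = (‖c‖ ^ 2 : ℝ) * dotProduct (star v) v := by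
  rw [star_smul, smul_dotProduct, dotProduct_smul, smul_smul, smul_eq_mul, Complex.ofReal_pow]
  exact congrArg (· * _) (RCLike.conj_mul c)

variable [DecidableEq n] {A : Matrix n n ℂ} {u v : n → ℂ}

namespace ConditionE

theorem isUnit_smul_one_sub (hA : ConditionE A) {z : ℂ} (hz : 1 < ‖z‖) :
    IsUnit (z • (1 : Matrix n n ℂ) - A) := by
  by_contra hu
  have hmem : z ∈ spectrum ℂ A := by rwa [spectrum.mem_iff, Algebra.algebraMap_eq_smul_one]
  rw [← Matrix.spectrum_toLin', ← Module.End.hasEigenvalue_iff_mem_spectrum] at hmem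
  have hz1 : z ≠ 1 := fun h1 => hz.ne' (by rw [h1, norm_one])
  exact (hA.2 z hmem hz1).not_gt hz

theorem exists_smul_of_mulVec_eq (hA : ConditionE A) (hu0 : u ≠ 0) (hu : A.mulVec u = u)
    (hv : A.mulVec v = v) : ∃ c : ℂ, v = c • u := by
  have hmem : ∀ {w}, A.mulVec w = w → w ∈ Module.End.eigenspace (Matrix.toLin' A) 1 :=
    fun hw => Module.End.mem_eigenspace_iff.2 (by simpa using hw)
  have hle : Module.finrank ℂ (Module.End.eigenspace (Matrix.toLin' A) 1) ≤ 1 := by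
    simpa only [Matrix.charpoly_toLin', hA.1] using
      LinearMap.finrank_eigenspace_le (Matrix.toLin' A) 1
  have hu0' : (⟨u, hmem hu⟩ : Module.End.eigenspace (Matrix.toLin' A) 1) ≠ 0 :=
    fun h0 => hu0 (congrArg Subtype.val h0)
  have hone := hle.antisymm (Module.finrank_pos_iff_exists_ne_zero.2 ⟨_, hu0'⟩)
  obtain ⟨c, hc⟩ := exists_smul_eq_of_finrank_eq_one hone hu0' ⟨v, hmem hv⟩
  exact ⟨c, (congrArg Subtype.val hc).symm⟩

theorem mulVec_eq_and_unit_iff (hA : ConditionE A) (hu : A.mulVec u = u)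
    (hu1 : dotProduct (star u) u = 1) :
    (A.mulVec v = v ∧ dotProduct (star v) v = 1) ↔ ∃ c : ℂ, ‖c‖ = 1 ∧ v = c • u := by
  constructor
  · rintro ⟨hv, hv1⟩
    have hu0 : u ≠ 0 := fun h0 => by simp [h0] at hu1
    obtain ⟨c, rfl⟩ := hA.exists_smul_of_mulVec_eq hu0 hu hv
    rw [star_smul_dotProduct_smul, hu1, mul_one, Complex.ofReal_eq_one] at hv1
    exact ⟨c, (pow_eq_one_iff_of_nonneg (norm_nonneg _) two_ne_zero).1 hv1, rfl⟩
  · rintro ⟨c, hc, rfl⟩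
    rw [Matrix.mulVec_smul, hu, star_smul_dotProduct_smul, hu1, hc]
    simp

end ConditionE

theorem eq_inv_mulVec_of_smul_eq_add {z : ℂ} {w : n → ℂ}
    (hz : IsUnit (z • (1 : Matrix n n ℂ) - A)) (hv : z • v = A.mulVec v + w) :
    v = (z • (1 : Matrix n n ℂ) - A)⁻¹.mulVec w := by
  have hw : (z • (1 : Matrix n n ℂ) - A).mulVec v = w := by
    rw [Matrix.sub_mulVec, Matrix.smul_mulVec, Matrix.one_mulVec, hv, add_sub_cancel_left]
  rw [← hw, Matrix.mulVec_mulVec,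
    Matrix.nonsing_inv_mul _ ((Matrix.isUnit_iff_isUnit_det _).1 hz), Matrix.one_mulVec]

variable {M : ℕ → Matrix n n ℂ} {a b : ℕ → n → ℂ} {z : ℂ}

theorem eq_inv_mulVec_sum_range {j : ℕ} (hz0 : z ≠ 0)
    (hz : IsUnit (z ^ j • (1 : Matrix n n ℂ) - M 0))
    (ha : a j = (z ^ j)⁻¹ • ∑ l ∈ Finset.range (j + 1),
      (j.choose l : ℂ) • (M (j - l)).mulVec (a l)) :
    a j = (z ^ j • (1 : Matrix n n ℂ) - M 0)⁻¹.mulVec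
      (∑ l ∈ Finset.range j, (j.choose l : ℂ) • (M (j - l)).mulVec (a l)) := by
  refine eq_inv_mulVec_of_smul_eq_add hz ?_
  rw [eq_inv_smul_iff₀ (pow_ne_zero j hz0), Finset.sum_range_succ, j.choose_self, Nat.cast_one,
    one_smul, Nat.sub_self] at ha
  rw [ha, add_comm]

theorem eq_of_moment_recursion (h0 : a 0 = b 0)
    (ha : ∀ j : ℕ, 1 ≤ j → a j = (z ^ j • (1 : Matrix n n ℂ) - M 0)⁻¹.mulVec
      (∑ l ∈ Finset.range j, (j.choose l : ℂ) • (M (j - l)).mulVec (a l)))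
    (hb : ∀ j : ℕ, 1 ≤ j → b j = (z ^ j • (1 : Matrix n n ℂ) - M 0)⁻¹.mulVec
      (∑ l ∈ Finset.range j, (j.choose l : ℂ) • (M (j - l)).mulVec (b l))) (j : ℕ) :
    a j = b j := by
  induction j using Nat.strong_induction_on with
  | _ j ih =>
    rcases j.eq_zero_or_pos with rfl | hj
    · exact h0
    · rw [ha j hj, hb j hj]
      exact congrArg _ (Finset.sum_congr rfl fun l hl => by rw [ih l (Finset.mem_range.1 hl)])

end LinearAlgebra

end TwoDirection

theorem theorem3p5_general (d r : ℕ) (hd : 2 ≤ d)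
    (Pp Pm : ℤ → Matrix (Fin r) (Fin r) ℝ) (φ : ℝ → Fin r → ℂ)
    (hφ : IsMultiscaling d Pp Pm φ)
    (horth : IsOrthogonal φ)
    (hsupp : HasCompactSupport φ)
    (hE : ConditionE (discreteMoment d Pp Pm 0)) :
    (∀ j : ℕ, Summable (discreteMomentTerm Pp Pm j)) ∧
    (∀ j : ℕ, Integrable (fun x : ℝ => (x ^ j) • doubled φ x)) ∧
    (discreteMoment d Pp Pm 0).mulVec (continuousMoment (doubled φ) 0)
        = continuousMoment (doubled φ) 0 ∧
    dotProduct (star (continuousMoment (doubled φ) 0)) (continuousMoment (doubled φ) 0) = 1 ∧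
    (∀ v : Fin r ⊕ Fin r → ℂ,
      ((discreteMoment d Pp Pm 0).mulVec v = v ∧ dotProduct (star v) v = 1) ↔
        ∃ c : ℂ, ‖c‖ = 1 ∧ v = c • continuousMoment (doubled φ) 0) ∧
    (∀ j : ℕ, 1 ≤ j →
      IsUnit ((d : ℂ) ^ j • (1 : Matrix (Fin r ⊕ Fin r) (Fin r ⊕ Fin r) ℂ)
        - discreteMoment d Pp Pm 0) ∧
      continuousMoment (doubled φ) j =
        ((d : ℂ) ^ j • (1 : Matrix (Fin r ⊕ Fin r) (Fin r ⊕ Fin r) ℂ)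
          - discreteMoment d Pp Pm 0)⁻¹.mulVec
          (∑ l ∈ Finset.range j, (j.choose l : ℂ) •
            (discreteMoment d Pp Pm (j - l)).mulVec (continuousMoment (doubled φ) l))) ∧
    (∀ a : ℕ → Fin r ⊕ Fin r → ℂ, a 0 = continuousMoment (doubled φ) 0 →
      (∀ j : ℕ, 1 ≤ j → a j =
        ((d : ℂ) ^ j • (1 : Matrix (Fin r ⊕ Fin r) (Fin r ⊕ Fin r) ℂ)
          - discreteMoment d Pp Pm 0)⁻¹.mulVec
          (∑ l ∈ Finset.range j, (j.choose l : ℂ) •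
            (discreteMoment d Pp Pm (j - l)).mulVec (a l))) →
      ∀ j : ℕ, a j = continuousMoment (doubled φ) j) ∧
    (∀ j : ℕ, continuousMoment φ j = upperHalf (continuousMoment (doubled φ) j)) ∧
    (∀ (Qp Qm : Fin (d - 1) → ℤ → Matrix (Fin r) (Fin r) ℝ)
      (ψ : Fin (d - 1) → ℝ → Fin r → ℂ),
      (∀ s, IsTwoDirectionSeries d (Qp s) (Qm s) φ (ψ s)) →
      ∀ (s : Fin (d - 1)) (j : ℕ), Integrable (fun x : ℝ => (x ^ j) • ψ s x) →
        (∀ i ≤ j, Summable (discreteMomentTerm (Qp s) (Qm s) i)) ∧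
        Integrable (fun x : ℝ => (x ^ j) • doubled (ψ s) x) ∧
        continuousMoment (doubled (ψ s)) j =
          ((d : ℂ) ^ j)⁻¹ • ∑ l ∈ Finset.range (j + 1), (j.choose l : ℂ) •
            (discreteMoment d (Qp s) (Qm s) (j - l)).mulVec (continuousMoment (doubled φ) l) ∧
        continuousMoment (ψ s) j = upperHalf (continuousMoment (doubled (ψ s)) j)) := by
  have hd0 : 0 < d := by omega
  obtain ⟨R, h⟩ := horth.exists_orthonormalShifts hφ.generates.memLp hsupp
  have hint : ∀ j : ℕ, Integrable fun x : ℝ => (x ^ j) • doubled φ x := h.integrable_pow_smul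
  have hintφ : ∀ j : ℕ, Integrable fun x : ℝ => (x ^ j) • φ x := fun j =>
    Integrable.of_eval fun i => (hint j).eval (Sum.inl i)
  have hmom := fun j => hφ.refinement.continuousMoment_doubled hd0 h (hintφ j)
  have hfix : (discreteMoment d Pp Pm 0).mulVec (continuousMoment (doubled φ) 0) =
      continuousMoment (doubled φ) 0 := by simpa using (hmom 0).symm
  have hone := hφ.generates.star_dotProduct_continuousMoment_zero hd h
  have hunit : ∀ j : ℕ, 1 ≤ j → IsUnit ((d : ℂ) ^ j • (1 : Matrix (Fin r ⊕ Fin r) _ ℂ) -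
      discreteMoment d Pp Pm 0) := fun j hj => hE.isUnit_smul_one_sub <| by
    rw [norm_pow, Complex.norm_natCast]
    exact one_lt_pow₀ (by exact_mod_cast hd) (by omega)
  have hrec := fun j hj =>
    eq_inv_mulVec_sum_range (Nat.cast_ne_zero.2 hd0.ne') (hunit j hj) (hmom j)
  exact ⟨fun j => hφ.refinement.summable_discreteMomentTerm hd0 h (hintφ j) le_rfl, hint, hfix,
    hone, fun v => hE.mulVec_eq_and_unit_iff hfix hone, fun j hj => ⟨hunit j hj, hrec j hj⟩,
    fun a ha0 ha => eq_of_moment_recursion ha0 ha hrec,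
    fun j => continuousMoment_eq_upperHalf (hintφ j), fun Qp Qm ψ hψ s j hj =>
      ⟨fun i => (hψ s).summable_discreteMomentTerm hd0 h hj, integrable_pow_smul_doubled hj,
        (hψ s).continuousMoment_doubled hd0 h hj, continuousMoment_eq_upperHalf hj⟩⟩

theorem theorem3p5 (d r : ℕ) (hd : 2 ≤ d)
    (Pp Pm : ℤ → Matrix (Fin r) (Fin r) ℝ) (φ : ℝ → Fin r → ℂ)
    (hφ : IsMultiscaling d Pp Pm φ)
    (horth : IsOrthogonal φ)
    (hsupp : HasCompactSupport φ)
    (hcont : Continuous φ)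
    (hE : ConditionE (discreteMoment d Pp Pm 0)) :
    -- the discrete and continuous moments of the doubled function exist
    (∀ j : ℕ, Summable (discreteMomentTerm Pp Pm j)) ∧
    (∀ j : ℕ, Integrable (fun x : ℝ => (x ^ j) • doubled φ x)) ∧
    -- the zeroth moment is the normalized fixed vector of `M_0`, unique up to a unimodular factor
    (discreteMoment d Pp Pm 0).mulVec (continuousMoment (doubled φ) 0)
        = continuousMoment (doubled φ) 0 ∧
    dotProduct (star (continuousMoment (doubled φ) 0)) (continuousMoment (doubled φ) 0) = 1 ∧
    (∀ v : Fin r ⊕ Fin r → ℂ,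
      ((discreteMoment d Pp Pm 0).mulVec v = v ∧ dotProduct (star v) v = 1) ↔
        ∃ c : ℂ, ‖c‖ = 1 ∧ v = c • continuousMoment (doubled φ) 0) ∧
    -- the recursion for the higher moments
    (∀ j : ℕ, 1 ≤ j →
      IsUnit ((d : ℂ) ^ j • (1 : Matrix (Fin r ⊕ Fin r) (Fin r ⊕ Fin r) ℂ)
        - discreteMoment d Pp Pm 0) ∧
      continuousMoment (doubled φ) j =
        ((d : ℂ) ^ j • (1 : Matrix (Fin r ⊕ Fin r) (Fin r ⊕ Fin r) ℂ)
          - discreteMoment d Pp Pm 0)⁻¹.mulVec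
          (∑ l ∈ Finset.range j, (j.choose l : ℂ) •
            (discreteMoment d Pp Pm (j - l)).mulVec (continuousMoment (doubled φ) l))) ∧
    -- the zeroth moment and the recursion determine all moments
    (∀ a : ℕ → Fin r ⊕ Fin r → ℂ, a 0 = continuousMoment (doubled φ) 0 →
      (∀ j : ℕ, 1 ≤ j → a j =
        ((d : ℂ) ^ j • (1 : Matrix (Fin r ⊕ Fin r) (Fin r ⊕ Fin r) ℂ)
          - discreteMoment d Pp Pm 0)⁻¹.mulVec
          (∑ l ∈ Finset.range j, (j.choose l : ℂ) •
            (discreteMoment d Pp Pm (j - l)).mulVec (a l))) →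
      ∀ j : ℕ, a j = continuousMoment (doubled φ) j) ∧
    -- the moments of `φ`
    (∀ j : ℕ, continuousMoment φ j = upperHalf (continuousMoment (doubled φ) j)) ∧
    -- the moments of the multiwavelets, as far as they exist
    (∀ (Qp Qm : Fin (d - 1) → ℤ → Matrix (Fin r) (Fin r) ℝ)
      (ψ : Fin (d - 1) → ℝ → Fin r → ℂ),
      (∀ s, IsTwoDirectionSeries d (Qp s) (Qm s) φ (ψ s)) →
      ∀ (s : Fin (d - 1)) (j : ℕ), Integrable (fun x : ℝ => (x ^ j) • ψ s x) →
        (∀ i ≤ j, Summable (discreteMomentTerm (Qp s) (Qm s) i)) ∧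
        Integrable (fun x : ℝ => (x ^ j) • doubled (ψ s) x) ∧
        continuousMoment (doubled (ψ s)) j =
          ((d : ℂ) ^ j)⁻¹ • ∑ l ∈ Finset.range (j + 1), (j.choose l : ℂ) •
            (discreteMoment d (Qp s) (Qm s) (j - l)).mulVec (continuousMoment (doubled φ) l) ∧
        continuousMoment (ψ s) j = upperHalf (continuousMoment (doubled (ψ s)) j)) :=
  theorem3p5_general d r hd Pp Pm φ hφ horth hsupp hE
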